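/- Let $n\ge 1$. For $u:\mathbb R^n\to\mathbb R\cup\{+\infty\}$ let $\mathrm{dom}(u)=\{x: u(x)\in\mathbb R\}$ and let $u^*(y)=\sup_{x\in\mathbb R^n}\big(\langle x,y\rangle-u(x)\big)$ be its Fenchel conjugate. Let $\mathcal L$ be the class of convex functions $u:\mathbb R^n\to\mathbb R\cup\{+\infty\}$ with $\mathrm{dom}(u)\neq\emptyset$ and $\lim_{\|x\|\to+\infty}u(x)=+\infty$, and let $\mathcal L'$ be the class of those $u\in\mathcal L$ with $\mathrm{dom}(u)=\mathbb R^n$ which are twice differentiable on $\mathbb R^n$ with positive definite Hessian at every point and satisfy $\lim_{\|x\|\to+\infty}u(x)/\|x\|=+\infty$. Let $\mathcal A=\{e^{-u}:u\in\mathcal L\}$ and $\mathcal A'=\{e^{-u}:u\in\mathcal L'\}$. For $f=e^{-u}$ and $g=e^{-v}$ in $\mathcal A$ and $t\ge 0$ put $f\oplus t\cdot g=e^{-u_t}$, where $u_t(x)=\inf_{y\in\mathbb R^n}\{u(x-y)+(vt)(y)\}$, with $(vt)(y)=t\,v(y/t)$ for $t>0$, while $(v0)(0)=0$ and $(v0)(y)=+\infty$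 for $y\neq 0$. Let $J(f)=\int_{\mathbb R^n}f\,dx$, and let $$\delta J(f,g)=\lim_{t\to0^+}\frac{J(f\oplus t\cdot g)-J(f)}{t}$$ whenever the limit exists. Let $\mu(f)=(\nabla u)_\sharp(f\,dx)$ be the push-forward of the measure $f\,dx$ under $\nabla u$. **Theorem.** Let $f=e^{-u}$ and $g=e^{-v}$ belong to $\mathcal A'$, and assume that $g$ is an admissible perturbation of $f$, that is, $u^*-c\,v^*$ is convex for some $c>0$. Then $f\oplus t\cdot g$ is integrable on $\mathbb R^n$ for every $t\ge0$, the function $\psi=v^*$ is finite on $\mathbb R^n$ and integrable with respect to $\mu(f)$, the limit $\delta J(f,g)$ exists and is finite, and $$\delta J(f,g)=\int_{\mathbb R^n}\psi\,d\mu(f).$$ -/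

import Mathlib

open Filter Topology MeasureTheory Set

namespace LogConcave

noncomputable section

/-- The Euclidean space `ℝⁿ`. -/
abbrev E (n : ℕ) : Type := EuclideanSpace ℝ (Fin n)

/-- The domain `{x | u x ∈ ℝ}` of an extended real valued function. -/
def dom {n : ℕ} (u : E n → EReal) : Set (E n) := {x | u x ≠ ⊥ ∧ u x ≠ ⊤}

/-- Convexity of an extended real valued function, i.e. convexity of its epigraph in `ℝⁿ × ℝ`. -/
def IsConvex {n : ℕ} (u : E n → EReal) : Prop :=
  Convex ℝ {p : E n × ℝ | u p.1 ≤ (p.2 : EReal)}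

/-- The gradient of (the finite part of) `u`; it is meaningful at interior points of `dom u` where
`u` is differentiable. -/
def grad {n : ℕ} (u : E n → EReal) : E n → E n := gradient (fun x => (u x).toReal)

/-- Class `C²₊`: `u` is twice differentiable on the interior of its domain, with positive definite
Hessian there. The Hessian at `x` is the derivative of the gradient at `x`. -/
def IsC2Plus {n : ℕ} (u : E n → EReal) : Prop :=
  ∀ x ∈ interior (dom u),
    DifferentiableAt ℝ (fun z => (u z).toReal) x ∧
    DifferentiableAt ℝ (grad u) x ∧
    ∀ w : E n, w ≠ 0 → 0 < inner ℝ (fderiv ℝ (grad u) x w) w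

/-- The Fenchel conjugate `u*(y) = sup_x (⟨x, y⟩ - u x)`. -/
def conj {n : ℕ} (u : E n → EReal) (y : E n) : EReal :=
  ⨆ x : E n, ((inner ℝ x y : ℝ) : EReal) - u x

/-- The infimal convolution `(u □ v)(x) = inf_y (u (x - y) + v y)`. -/
def infConv {n : ℕ} (u v : E n → EReal) (x : E n) : EReal :=
  ⨅ y : E n, u (x - y) + v y

open Classical in
/-- The right scalar multiplication `u α`, for a real number `α ≥ 0`: `(u α)(x) = α u (x / α)` for
`α > 0`, and `u 0` is the indicatrix function of `{0}`. -/
def rightMul {n : ℕ} (u : E n → EReal) (α : ℝ) (x : E n) : EReal :=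
  if 0 < α then (α : EReal) * u (α⁻¹ • x) else if x = 0 then 0 else ⊤

/-- The class `ℒ` of the proper convex functions `u : ℝⁿ → ℝ ∪ {+∞}` such that `u x → +∞` as
`‖x‖ → +∞`. -/
def classL (n : ℕ) : Set (E n → EReal) :=
  {u | (∀ x, u x ≠ ⊥) ∧ (dom u).Nonempty ∧ IsConvex u ∧
    Tendsto u (Bornology.cobounded (E n)) (𝓝 ⊤)}

/-- The class `ℒ'` of the functions in `ℒ` that are finite on `ℝⁿ`, of class `C²₊`, and of
superlinear growth. -/
def classL' (n : ℕ) : Set (E n → EReal) :=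
  {u | u ∈ classL n ∧ dom u = univ ∧ IsC2Plus u ∧
    Tendsto (fun x => (u x).toReal / ‖x‖) (Bornology.cobounded (E n)) atTop}

/-- The function `e^{-u}`, with `e^{-∞} = 0`. -/
def expNeg {n : ℕ} (u : E n → EReal) (x : E n) : ℝ := (EReal.exp (-(u x))).toReal

/-- The function `u = -log f`, with `-log 0 = +∞`; it recovers `u` from `f = e^{-u}`. -/
def negLog {n : ℕ} (f : E n → ℝ) (x : E n) : EReal := -(ENNReal.log (ENNReal.ofReal (f x)))

/-- The class `𝒜` of log-concave functions `e^{-u}`, `u ∈ ℒ`. -/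
def classA (n : ℕ) : Set (E n → ℝ) := {f | ∃ u ∈ classL n, f = expNeg u}

/-- The class `𝒜'` of the functions `f ∈ 𝒜` such that `-log f ∈ ℒ'`. -/
def classA' (n : ℕ) : Set (E n → ℝ) := {f | f ∈ classA n ∧ negLog f ∈ classL' n}

/-- The combination `α · f ⊕ β · g = e^{-[(u α) □ (v β)]}`, where `f = e^{-u}`, `g = e^{-v}` and
`α, β ≥ 0`. -/
def comb {n : ℕ} (α : ℝ) (f : E n → ℝ) (β : ℝ) (g : E n → ℝ) : E n → ℝ :=
  expNeg (infConv (rightMul (negLog f) α) (rightMul (negLog g) β))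

/-- The total mass functional `J f = ∫ f dx`. -/
def totalMass {n : ℕ} (f : E n → ℝ) : ℝ := ∫ x, f x

/-- The first variation `δJ(f, g) = lim_{t → 0⁺} (J (f ⊕ t · g) - J f) / t` exists and is the
(finite) real number `l`. -/
def HasFirstVariation {n : ℕ} (f g : E n → ℝ) (l : ℝ) : Prop :=
  Tendsto (fun t : ℝ => (totalMass (comb 1 f t g) - totalMass f) / t) (𝓝[>] 0) (𝓝 l)

/-- The measure `μ(f) = (∇u)_♯ (f dx)`, where `f = e^{-u}`. -/
def gradMeasure {n : ℕ} (f : E n → ℝ) : Measure (E n) :=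
  (volume.withDensity (fun x => ENNReal.ofReal (f x))).map (grad (negLog f))

/-- `g = e^{-v}` is an admissible perturbation for `f = e^{-u}`: the function `u* - c v*` is convex
for some `c > 0`. -/
def IsAdmissible {n : ℕ} (f g : E n → ℝ) : Prop :=
  ∃ c : ℝ, 0 < c ∧ IsConvex (fun y => conj (negLog f) y - (c : EReal) * conj (negLog g) y)

end

end LogConcave

/-!
The first variation of `J (e ^ (-U))` in the direction `e ^ (-V)`. Let `W t` be the infimal
convolution of `U` with `V t`, so that `f ⊕ t · g = e ^ (-W t)`, and let `U*`, `ψ = V*` be the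
conjugates.

Testing the infimum that defines `W t x`, and using that `∇ U x` is a subgradient, gives
`(U x - W t x) / t → ψ (∇ U x)` as `t → 0⁺` for every `x` (`tendsto_sub_div_conj_gradient`). Hence
the difference quotients of `e ^ (-W t)` converge pointwise to `ψ (∇ U) e ^ (-U)`, and the point is
to exchange this limit with the integral. The quotients are bounded below by `-|V 0| e ^ (-U)`.

For an upper bound, let `⟪a, ·⟫ + b` be an affine minorant of the finite convex function
`U* - c V*`. With `s = t / c` one has `U* + t V* ≤ (1 + s) U* - s (⟪a, ·⟫ + b)`, so that
`W t x ≥ (1 + s) U ((x + s a) / (1 + s)) + s b` (`exists_dilation_le`). This shows that `e ^ (-W t)`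
is integrable. The difference quotients of the resulting majorant of `e ^ (-W t)` are not compared
with a fixed integrable function; it suffices that they converge pointwise and that their integrals
converge to the integral of the limit (`tendsto_integral_dilation`). Indeed, a change of variables
turns the integral of the majorant into `e ^ (-s b) (1 + s) ^ d ∫ e ^ (-(1 + s) U)`, with `d` the
dimension, which is differentiated under the integral sign, and the result agrees with the integral
of the pointwise limit because
`∫ ⟪∇ U x, x - a⟫ e ^ (-U x) dx = d ∫ e ^ (-U)` (`integral_inner_gradient_mul_exp_neg`).
A generalised dominated convergence theorem (`tendsto_integral_of_le_of_tendsto_integral`)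
concludes.
-/

namespace LogConcave

/-! ### Convex functions of superlinear growth -/

section Real

variable {F : Type*} [NormedAddCommGroup F] [InnerProductSpace ℝ F] [FiniteDimensional ℝ F]

/-- A convex `C¹` function `U : F → ℝ` with `U x / ‖x‖ → ∞` at infinity. These are the properties of
the elements of `ℒ'` on which the first variation depends; a twice differentiable function is `C¹`
since its gradient is differentiable. -/
structure IsSuperlinearConvex (U : F → ℝ) : Prop where
  convexOn : ConvexOn ℝ univ U
  differentiable : Differentiable ℝ U
  continuous_gradient : Continuous (gradient U)
  superlinear : Tendsto (fun x => U x / ‖x‖) (Bornology.cobounded F) atTop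

theorem hasDerivAt_comp_gradient {U : F → ℝ} (hU : Differentiable ℝ U) {γ : ℝ → F} {γ' : F} {r : ℝ}
    (hγ : HasDerivAt γ γ' r) : HasDerivAt (fun r => U (γ r)) (inner ℝ (gradient U (γ r)) γ') r := by
  have h := (hU (γ r)).hasFDerivAt.comp_hasDerivAt r hγ
  rwa [← inner_gradient_left] at h

namespace IsSuperlinearConvex

variable {U : F → ℝ}

/-- The gradient of a differentiable convex function is a subgradient. -/
theorem add_inner_gradient_le (hU : IsSuperlinearConvex U) (x z : F) :
    U x + inner ℝ (gradient U x) (z - x) ≤ U z := by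
  have hγ : HasDerivAt (fun r : ℝ => x + r • (z - x)) (z - x) 0 := by
    simpa using ((hasDerivAt_id (0 : ℝ)).smul_const (z - x)).const_add x
  have hd := hasDerivAt_comp_gradient hU.differentiable hγ
  have hc : ConvexOn ℝ univ (fun r : ℝ => U (x + r • (z - x))) := by
    have h := hU.convexOn.comp_affineMap (AffineMap.lineMap x z : ℝ →ᵃ[ℝ] F)
    have he : (U ∘ (AffineMap.lineMap x z : ℝ →ᵃ[ℝ] F)) = fun r : ℝ => U (x + r • (z - x)) := by
      funext r
      simp [AffineMap.lineMap_apply, add_comm]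
    rwa [he, preimage_univ] at h
  have h := hc.le_slope_of_hasDerivAt (mem_univ 0) (mem_univ 1) one_pos hd
  simp [slope_def_field, -inner_gradient_left] at h
  linarith

theorem exists_mul_norm_sub_le (hU : IsSuperlinearConvex U) {k : ℝ} (hk : 0 < k) :
    ∃ C : ℝ, ∀ x, k * ‖x‖ - C ≤ U x := by
  have h := hU.superlinear.eventually_ge_atTop k
  obtain ⟨R, -, hR⟩ := (hasBasis_cobounded_norm (E := F)).eventually_iff.1 h
  have hcont : ContinuousOn (fun x => U x - k * ‖x‖) (Metric.closedBall 0 R) :=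
    (hU.differentiable.continuous.sub (continuous_const.mul continuous_norm)).continuousOn
  obtain ⟨m, hm⟩ := ((isCompact_closedBall (0 : F) R).image_of_continuousOn hcont).bddBelow
  refine ⟨|m|, fun x => ?_⟩
  by_cases hx : ‖x‖ ≤ R
  · have := hm (mem_image_of_mem _ (mem_closedBall_zero_iff.2 hx))
    linarith [neg_abs_le m]
  · have h1 : k ≤ U x / ‖x‖ := hR (not_le.1 hx).le
    have h0 : 0 < ‖x‖ := by
      rcases (norm_nonneg x).eq_or_lt with h0 | h0
      · rw [← h0, div_zero] at h1; linarith
      · exact h0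
    rw [le_div_iff₀ h0] at h1
    linarith [abs_nonneg m]

theorem exists_forall_le (hU : IsSuperlinearConvex U) : ∃ m : ℝ, ∀ x, m ≤ U x := by
  obtain ⟨C, hC⟩ := hU.exists_mul_norm_sub_le one_pos
  exact ⟨-C, fun x => by linarith [hC x, norm_nonneg x]⟩

/-- By superlinear growth the Fenchel conjugate is finite everywhere. -/
theorem bddAbove_inner_sub (hU : IsSuperlinearConvex U) (y : F) :
    BddAbove (range fun x => inner ℝ x y - U x) := by
  obtain ⟨C, hC⟩ := hU.exists_mul_norm_sub_le (k := ‖y‖ + 1) (by positivity)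
  refine ⟨C, ?_⟩
  rintro _ ⟨x, rfl⟩
  have := real_inner_le_norm x y
  have := hC x
  have := norm_nonneg x
  dsimp only
  nlinarith

end IsSuperlinearConvex

variable [MeasurableSpace F] [BorelSpace F]

theorem integrable_exp_neg_mul_norm {r : ℝ} (hr : 0 < r) :
    Integrable (fun x : F => Real.exp (-(r * ‖x‖))) := by
  set m : ℕ := Module.finrank ℝ F + 1 with hm
  have h1 : Integrable (fun x : F => (1 + ‖x‖) ^ (-(m : ℝ))) :=
    integrable_one_add_norm (by simp [hm])
  refine (h1.const_mul (Real.exp r * (m.factorial / r ^ m))).mono' (by fun_prop)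
    (ae_of_all _ fun x => ?_)
  have hy : 0 < 1 + ‖x‖ := by positivity
  have h2 := Real.pow_div_factorial_le_exp (r * (1 + ‖x‖)) (by positivity) m
  rw [Real.norm_of_nonneg (Real.exp_nonneg _), Real.rpow_neg hy.le, Real.rpow_natCast]
  have h3 : Real.exp (-(r * ‖x‖)) = Real.exp r * (Real.exp (r * (1 + ‖x‖)))⁻¹ := by
    rw [← Real.exp_neg, ← Real.exp_add]; ring_nf
  rw [h3, mul_assoc]
  gcongr
  calc (Real.exp (r * (1 + ‖x‖)))⁻¹ ≤ ((r * (1 + ‖x‖)) ^ m / m.factorial)⁻¹ := by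
        gcongr
    _ = _ := by rw [mul_pow]; field_simp

namespace IsSuperlinearConvex

variable {U : F → ℝ}

theorem integrable_exp_neg_mul (hU : IsSuperlinearConvex U) {p : ℝ} (hp : 0 < p) :
    Integrable (fun x => Real.exp (-(p * U x))) := by
  obtain ⟨C, hC⟩ := hU.exists_mul_norm_sub_le one_pos
  have hc := hU.differentiable.continuous
  refine ((integrable_exp_neg_mul_norm (F := F) hp).const_mul (Real.exp (p * C))).mono'
    (by fun_prop) (ae_of_all _ fun x => ?_)
  rw [Real.norm_of_nonneg (Real.exp_nonneg _), ← Real.exp_add]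
  gcongr
  nlinarith [hC x]

theorem integrable_exp_neg (hU : IsSuperlinearConvex U) :
    Integrable (fun x => Real.exp (-U x)) := by
  simpa using hU.integrable_exp_neg_mul one_pos

/-- Differentiation of `∫ e ^ (-(1 + s) U)` under the integral sign at `s = 0`. -/
theorem hasDerivAt_integral_exp_neg_mul (hU : IsSuperlinearConvex U) :
    Integrable (fun x => U x * Real.exp (-U x)) ∧
      HasDerivAt (fun s : ℝ => ∫ x, Real.exp (-((1 + s) * U x)))
        (-∫ x, U x * Real.exp (-U x)) 0 := by
  obtain ⟨m, hm⟩ := hU.exists_forall_le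
  have hc := hU.differentiable.continuous
  have key := hasDerivAt_integral_of_dominated_loc_of_deriv_le (μ := (volume : Measure F))
    (F := fun s x => Real.exp (-((1 + s) * U x)))
    (F' := fun s x => -(U x * Real.exp (-((1 + s) * U x)))) (x₀ := (0 : ℝ))
    (s := Ioo (-(1 / 2)) (1 / 2))
    (bound := fun x => 4 * Real.exp (-(1 / 4 * U x)) + |m| * Real.exp (-(3 / 2 * U x)))
    (Ioo_mem_nhds (by norm_num) (by norm_num))
    (Eventually.of_forall fun s => by fun_prop)
    (by simpa using hU.integrable_exp_neg) (by fun_prop)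
    (ae_of_all _ fun x s hs => ?_)
    (((hU.integrable_exp_neg_mul (by norm_num)).const_mul _).add
      ((hU.integrable_exp_neg_mul (by norm_num)).const_mul _))
    (ae_of_all _ fun x s _ => ?_)
  · have h1 := key.1.neg
    have h2 := key.2
    simp only [Pi.neg_def, neg_neg, add_zero, one_mul] at h1
    simp only [add_zero, one_mul, integral_neg] at h2
    exact ⟨h1, h2⟩
  · rw [norm_neg, norm_mul, Real.norm_eq_abs, Real.norm_of_nonneg (Real.exp_nonneg _)]
    obtain ⟨hs1, hs2⟩ := hs
    rcases le_or_gt 0 (U x) with h | h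
    · have h1 : |U x| * Real.exp (-((1 + s) * U x)) ≤ 4 * Real.exp (-(1 / 4 * U x)) := by
        rw [abs_of_nonneg h]
        have h2 : U x ≤ 4 * Real.exp (1 / 4 * U x) := by
          linarith [Real.add_one_le_exp (1 / 4 * U x)]
        calc U x * Real.exp (-((1 + s) * U x))
            ≤ (4 * Real.exp (1 / 4 * U x)) * Real.exp (-(1 / 2 * U x)) := by
              gcongr; nlinarith
          _ = 4 * Real.exp (-(1 / 4 * U x)) := by
              rw [mul_assoc, ← Real.exp_add]; ring_nf
      have : 0 ≤ |m| * Real.exp (-(3 / 2 * U x)) := by positivity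
      linarith
    · have h1 : |U x| * Real.exp (-((1 + s) * U x)) ≤ |m| * Real.exp (-(3 / 2 * U x)) := by
        have h2 : |U x| ≤ |m| := abs_le_abs_of_nonpos h.le (hm x)
        gcongr ?_ * Real.exp ?_
        nlinarith
      have : 0 ≤ 4 * Real.exp (-(1 / 4 * U x)) := by positivity
      linarith
  · have h1 : HasDerivAt (fun s : ℝ => -((1 + s) * U x)) (-U x) s := by
      simpa using! (((hasDerivAt_id s).const_add 1).mul_const (U x)).neg
    exact h1.exp.congr_deriv (by ring)

end IsSuperlinearConvex

/-! ### A generalised dominated convergence theorem -/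

/-- A generalised dominated convergence theorem: the functions `g i` have an integrable lower bound
independent of `i`, and upper bounds `G i` that converge together with their integrals. -/
theorem tendsto_integral_of_le_of_tendsto_integral {α ι : Type*} [MeasurableSpace α]
    {μ : Measure α} {l : Filter ι} [l.IsCountablyGenerated] {g G : ι → α → ℝ} {g' G' B : α → ℝ}
    (hg : ∀ᶠ i in l, Integrable (g i) μ) (hG : ∀ᶠ i in l, Integrable (G i) μ)
    (hB : Integrable B μ) (hG' : Integrable G' μ)
    (hBg : ∀ᶠ i in l, ∀ x, -B x ≤ g i x) (hgG : ∀ᶠ i in l, ∀ x, g i x ≤ G i x)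
    (hgl : ∀ x, Tendsto (fun i => g i x) l (𝓝 (g' x)))
    (hGl : ∀ x, Tendsto (fun i => G i x) l (𝓝 (G' x)))
    (hint : Tendsto (fun i => ∫ x, G i x ∂μ) l (𝓝 (∫ x, G' x ∂μ))) :
    Tendsto (fun i => ∫ x, g i x ∂μ) l (𝓝 (∫ x, g' x ∂μ)) := by
  rcases l.eq_or_neBot with rfl | hl
  · simp
  have hBd : Integrable (fun x => |G' x| + |B x|) μ := hG'.abs.add hB.abs
  have hmin : Tendsto (fun i => ∫ x, min (g i x) (G' x) ∂μ) l (𝓝 (∫ x, g' x ∂μ)) := by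
    refine tendsto_integral_filter_of_dominated_convergence _ ?_ ?_ hBd ?_
    · filter_upwards [hg] with i hi using (hi.inf hG').aestronglyMeasurable
    · filter_upwards [hBg] with i hi
      refine ae_of_all _ fun x => abs_le.2 ⟨?_, ?_⟩
      · refine le_min ?_ ?_
        · linarith [hi x, le_abs_self (B x), abs_nonneg (G' x)]
        · linarith [neg_abs_le (G' x), abs_nonneg (B x)]
      · linarith [min_le_right (g i x) (G' x), le_abs_self (G' x), abs_nonneg (B x)]
    · refine ae_of_all _ fun x => ?_
      have hle : g' x ≤ G' x := le_of_tendsto_of_tendsto (hgl x) (hGl x) (hgG.mono fun i hi => hi x)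
      simpa [min_eq_left hle] using (hgl x).min (tendsto_const_nhds (x := G' x))
  have hGmin : Tendsto (fun i => ∫ x, min (G i x) (G' x) ∂μ) l (𝓝 (∫ x, G' x ∂μ)) := by
    refine tendsto_integral_filter_of_dominated_convergence _ ?_ ?_ hBd ?_
    · filter_upwards [hG] with i hi using (hi.inf hG').aestronglyMeasurable
    · filter_upwards [hBg, hgG] with i hi hi'
      refine ae_of_all _ fun x => abs_le.2 ⟨?_, ?_⟩
      · refine le_min ?_ ?_
        · linarith [hi x, hi' x, le_abs_self (B x), abs_nonneg (G' x)]
        · linarith [neg_abs_le (G' x), abs_nonneg (B x)]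
      · linarith [min_le_right (G i x) (G' x), le_abs_self (G' x), abs_nonneg (B x)]
    · refine ae_of_all _ fun x => ?_
      simpa using (hGl x).min (tendsto_const_nhds (x := G' x))
  -- With pointwise minima, `0 ≤ g - min g G' ≤ G - min G G'`, and the integral of the right
  -- side tends to zero.
  have hup : Tendsto (fun i => ∫ x, min (g i x) (G' x) ∂μ +
      (∫ x, G i x ∂μ - ∫ x, min (G i x) (G' x) ∂μ)) l (𝓝 (∫ x, g' x ∂μ)) := by
    simpa using hmin.add (hint.sub hGmin)
  refine tendsto_of_tendsto_of_tendsto_of_le_of_le' hmin hup ?_ ?_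
  · filter_upwards [hg] with i hi
    exact integral_mono (hi.inf hG') hi fun x => min_le_left _ _
  · filter_upwards [hg, hG, hgG] with i hi hi2 hi3
    have h1 : Integrable (fun x => min (g i x) (G' x)) μ := hi.inf hG'
    have h2 : Integrable (fun x => min (G i x) (G' x)) μ := hi2.inf hG'
    have h3 : Integrable (fun x => G i x - min (G i x) (G' x)) μ := hi2.sub h2
    rw [← integral_sub hi2 h2, ← integral_add h1 h3]
    refine integral_mono hi (h1.add h3) fun x => ?_
    have := hi3 x
    dsimp only
    rcases le_total (g i x) (G' x) with h | h <;> rcases le_total (G i x) (G' x) with h' | h' <;>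
      simp [h, h'] <;> linarith

/-! ### The divergence theorem for `(x - a) e ^ (-U)` -/

namespace IsSuperlinearConvex

variable {U : F → ℝ}

/-- The divergence theorem for the vector field `(x - a) e ^ (-U)`. Integrability of the products
`(x - a)ᵢ ∂ᵢU e ^ (-U)` is not clear in advance, so the identity is derived from the scaling
`∫ e ^ (-U (a + ρ • x)) dx = ρ ^ (-d) ∫ e ^ (-U)`: differentiating along rays gives an integrand
bounded below by a multiple of `e ^ (-U)`, since `⟪∇ U x, x - a⟫ ≥ U x - U a`, so that
Fubini's theorem applies after a shift by a natural number `k`. -/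
theorem integral_inner_gradient_mul_exp_neg (hU : IsSuperlinearConvex U) (a : F) :
    Integrable (fun x => inner ℝ (gradient U x) (x - a) * Real.exp (-U x)) ∧
      ∫ x, inner ℝ (gradient U x) (x - a) * Real.exp (-U x) =
        Module.finrank ℝ F * ∫ x, Real.exp (-U x) := by
  obtain ⟨m, hm⟩ := hU.exists_forall_le
  -- `k` makes `⟪∇ U x, x - a⟫ + k` nonnegative
  obtain ⟨k, hk⟩ := exists_nat_ge (U a - m)
  set d := Module.finrank ℝ F with hd
  set J := ∫ x, Real.exp (-U x) with hJ
  have hUc := hU.differentiable.continuous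
  have hgc := hU.continuous_gradient
  have hfi := hU.integrable_exp_neg
  set P : F → ℝ := fun x => (inner ℝ (gradient U x) (x - a) + k) * Real.exp (-U x) with hP
  have hP0 : ∀ x, 0 ≤ P x := fun x => by
    refine mul_nonneg ?_ (Real.exp_nonneg _)
    have h1 := hU.add_inner_gradient_le x a
    rw [← neg_sub x a, inner_neg_right] at h1
    linarith [hm x]
  have hPc : Continuous P := by fun_prop
  -- `Φ x` is the derivative of `ρ ↦ -ρ ^ (-k) * exp (-U (a + ρ • x))`
  set Φ : F → ℝ → ℝ := fun x ρ => ρ ^ (-(k : ℤ) - 1) * P (a + ρ • x) with hΦ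
  have hderiv : ∀ x : F, ∀ ρ : ℝ, 0 < ρ →
      HasDerivAt (fun ρ : ℝ => -(ρ ^ (-(k : ℤ)) * Real.exp (-U (a + ρ • x)))) (Φ x ρ) ρ := by
    intro x ρ hρ
    have hγ : HasDerivAt (fun ρ : ℝ => a + ρ • x) x ρ := by
      simpa using ((hasDerivAt_id ρ).smul_const x).const_add a
    have h1 := (hasDerivAt_comp_gradient hU.differentiable hγ).neg.exp
    have h2 := hasDerivAt_zpow (-(k : ℤ)) ρ (Or.inl hρ.ne')
    refine (h2.mul h1).neg.congr_deriv ?_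
    have h3 : ρ ^ (-(k : ℤ)) = ρ ^ (-(k : ℤ) - 1) * ρ := by
      rw [← zpow_add_one₀ hρ.ne']; congr 1; ring
    simp only [hΦ, hP, add_sub_cancel_left, inner_smul_right, Pi.neg_apply]
    rw [h3]
    push_cast
    ring
  have hcont : ∀ x : F, ContinuousOn (Φ x) (Icc 1 2) := fun x =>
    (continuousOn_id.zpow₀ _ fun ρ hρ => Or.inl (by simp only [id]; linarith [hρ.1])).mul
      (by fun_prop)
  have hint : ∀ x : F, IntervalIntegrable (Φ x) volume 1 2 := fun x =>
    ContinuousOn.intervalIntegrable (by rw [uIcc_of_le one_le_two]; exact hcont x)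
  have hFTC : ∀ x : F, ∫ ρ in (1 : ℝ)..2, Φ x ρ =
      Real.exp (-U (a + x)) - 2 ^ (-(k : ℤ)) * Real.exp (-U (a + (2 : ℝ) • x)) := by
    intro x
    rw [intervalIntegral.integral_eq_sub_of_hasDerivAt (fun ρ hρ => hderiv x ρ ?_) (hint x)]
    · simp
      ring
    · rw [uIcc_of_le one_le_two] at hρ
      linarith [hρ.1]
  set ν : Measure ℝ := volume.restrict (Ioc 1 2) with hν
  have hνΦ : ∀ x, ∫ ρ, Φ x ρ ∂ν =
      Real.exp (-U (a + x)) - 2 ^ (-(k : ℤ)) * Real.exp (-U (a + (2 : ℝ) • x)) := fun x => by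
    rw [← hFTC, intervalIntegral.integral_of_le one_le_two]
  have hI1 : Integrable (fun x => Real.exp (-U (a + x))) := hfi.comp_add_left a
  have hI2 : Integrable (fun x => Real.exp (-U (a + (2 : ℝ) • x))) :=
    Integrable.comp_smul hI1 two_ne_zero
  have hmeas : AEStronglyMeasurable (Function.uncurry Φ) (volume.prod ν) := by
    refine Measurable.aestronglyMeasurable ?_
    have h1 : Measurable fun p : F × ℝ => p.2 ^ (-(k : ℤ) - 1) := measurable_snd.pow_const _
    have h2 : Continuous fun p : F × ℝ => P (a + p.2 • p.1) := by fun_prop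
    exact h1.mul h2.measurable
  have hΦ0 : ∀ x, ∀ ρ ∈ Ioc (1 : ℝ) 2, 0 ≤ Φ x ρ := fun x ρ hρ =>
    mul_nonneg (zpow_nonneg (by linarith [hρ.1]) _) (hP0 _)
  have hprod : Integrable (Function.uncurry Φ) (volume.prod ν) := by
    rw [integrable_prod_iff hmeas]
    refine ⟨ae_of_all _ fun x => ?_, ?_⟩
    · exact (intervalIntegrable_iff_integrableOn_Ioc_of_le one_le_two).1 (hint x)
    · have he : (fun x => ∫ ρ, ‖Function.uncurry Φ (x, ρ)‖ ∂ν) = fun x =>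
          Real.exp (-U (a + x)) - 2 ^ (-(k : ℤ)) * Real.exp (-U (a + (2 : ℝ) • x)) := by
        funext x
        rw [← hνΦ]
        exact setIntegral_congr_fun measurableSet_Ioc fun ρ hρ =>
          Real.norm_of_nonneg (hΦ0 x ρ hρ)
      rw [he]
      exact hI1.sub (hI2.const_mul _)
  have hPi : Integrable P := by
    have hν0 : NeZero ν := ⟨by simp [hν]⟩
    obtain ⟨ρ, h1, h2⟩ := ((hprod.prod_left_ae).and (ae_restrict_mem measurableSet_Ioc)).exists
    have hρ : ρ ≠ 0 := by linarith [h2.1]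
    have h3 : Integrable fun x => P (a + ρ • x) := by
      refine (h1.const_mul (ρ ^ (-(k : ℤ) - 1))⁻¹).congr (ae_of_all _ fun x => ?_)
      simp only [Function.uncurry, hΦ]
      rw [inv_mul_cancel_left₀ (zpow_ne_zero _ hρ)]
    have h4 := (integrable_comp_smul_iff volume (fun y => P (a + y)) hρ).1 h3
    simpa using h4.comp_add_left (-a)
  have hJscale : ∀ (Q : F → ℝ) (ρ : ℝ), 0 < ρ →
      ∫ x, Q (a + ρ • x) = ρ ^ (-(d : ℤ)) * ∫ x, Q x := by
    intro Q ρ hρ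
    rw [Measure.integral_comp_smul volume (fun y => Q (a + y)) ρ, integral_add_left_eq_self,
      abs_of_nonneg (by positivity), zpow_neg, zpow_natCast, smul_eq_mul]
  have hswap := integral_integral_swap hprod
  have hlhs : ∫ x, ∫ ρ, Φ x ρ ∂ν = (1 - 2 ^ (-((k + d : ℕ) : ℤ))) * J := by
    simp only [hνΦ]
    rw [integral_sub hI1 (hI2.const_mul _), integral_const_mul,
      hJscale (fun x => Real.exp (-U x)) 2 two_pos,
      integral_add_left_eq_self (fun x => Real.exp (-U x)) a]
    rw [Nat.cast_add, neg_add, zpow_add₀ two_ne_zero]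
    ring
  set A := ∫ ρ in (1 : ℝ)..2, ρ ^ (-((k + d : ℕ) : ℤ) - 1) with hA
  have hrhs : ∫ ρ, (∫ x, Φ x ρ) ∂ν = A * ∫ x, P x := by
    rw [hA, intervalIntegral.integral_of_le one_le_two, ← integral_mul_const]
    refine setIntegral_congr_fun measurableSet_Ioc fun ρ hρ => ?_
    have hρ0 : 0 < ρ := by linarith [hρ.1]
    simp only [hΦ]
    rw [integral_const_mul, hJscale P ρ hρ0, ← mul_assoc, ← zpow_add₀ hρ0.ne']
    congr 2
    push_cast
    ring
  have hAc : ContinuousOn (fun ρ : ℝ => ρ ^ (-((k + d : ℕ) : ℤ) - 1)) (uIcc 1 2) := by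
    rw [uIcc_of_le one_le_two]
    exact continuousOn_id.zpow₀ _ fun ρ hρ => Or.inl (by simp only [id]; linarith [hρ.1])
  have hApos : 0 < A := by
    refine intervalIntegral.intervalIntegral_pos_of_pos_on hAc.intervalIntegrable
      (fun ρ hρ => zpow_pos (by linarith [hρ.1]) _) one_lt_two
  have hAN : ((k + d : ℕ) : ℝ) * A = 1 - 2 ^ (-((k + d : ℕ) : ℤ)) := by
    rw [hA, ← intervalIntegral.integral_const_mul,
      intervalIntegral.integral_eq_sub_of_hasDerivAt
        (f := fun ρ : ℝ => -(ρ ^ (-((k + d : ℕ) : ℤ)))) (fun ρ hρ => ?_)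
        (hAc.intervalIntegrable.const_mul _)]
    · simp
      ring
    · rw [uIcc_of_le one_le_two] at hρ
      have hρ0 : ρ ≠ 0 := by linarith [hρ.1]
      refine (hasDerivAt_zpow (-((k + d : ℕ) : ℤ)) ρ (Or.inl hρ0)).neg.congr_deriv ?_
      push_cast
      ring
  have hPint : ∫ x, P x = ((k + d : ℕ) : ℝ) * J := by
    rw [hlhs, hrhs, ← hAN] at hswap
    have : A * (∫ x, P x) = A * (((k + d : ℕ) : ℝ) * J) := by linarith
    exact mul_left_cancel₀ hApos.ne' this
  have hsplit : (fun x => inner ℝ (gradient U x) (x - a) * Real.exp (-U x)) =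
      fun x => P x - k * Real.exp (-U x) := by
    funext x
    simp only [hP]
    ring
  rw [hsplit]
  refine ⟨hPi.sub (hfi.const_mul _), ?_⟩
  rw [integral_sub hPi (hfi.const_mul _), integral_const_mul, hPint]
  push_cast
  ring

end IsSuperlinearConvex

end Real

/-! ### Difference quotients and the infimal convolution -/

section Variation

variable {F : Type*} [NormedAddCommGroup F] [InnerProductSpace ℝ F]

theorem tendsto_exp_mul_sub_one_div {q : ℝ → ℝ} {q₀ : ℝ} (hq : Tendsto q (𝓝[>] 0) (𝓝 q₀)) :
    Tendsto (fun t => (Real.exp (t * q t) - 1) / t) (𝓝[>] 0) (𝓝 q₀) := by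
  have h0 : Tendsto (fun t : ℝ => t * q t) (𝓝[>] 0) (𝓝 0) := by
    simpa using (tendsto_nhdsWithin_of_tendsto_nhds tendsto_id).mul hq
  have h1 : Tendsto (fun t : ℝ => q t * Real.exp (t * q t)) (𝓝[>] 0) (𝓝 q₀) := by
    simpa using hq.mul ((Real.continuous_exp.tendsto 0).comp h0)
  refine tendsto_of_tendsto_of_tendsto_of_le_of_le' hq h1 ?_ ?_
  · filter_upwards [self_mem_nhdsWithin] with t ht
    rw [le_div_iff₀ ht]
    linarith [Real.add_one_le_exp (t * q t)]
  · filter_upwards [self_mem_nhdsWithin] with t ht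
    rw [div_le_iff₀ ht]
    have h2 := Real.add_one_le_exp (-(t * q t))
    have h3 : Real.exp (-(t * q t)) * Real.exp (t * q t) = 1 := by rw [← Real.exp_add]; simp
    nlinarith [Real.exp_pos (t * q t)]

/-- The difference quotient of `t ↦ e ^ (-w t)` at `0⁺`, where `w` has the one-sided derivative
`-q₀` and starts from `u`. -/
theorem tendsto_exp_neg_sub_div {w : ℝ → ℝ} {u q₀ : ℝ}
    (hw : Tendsto (fun t => (u - w t) / t) (𝓝[>] 0) (𝓝 q₀)) :
    Tendsto (fun t => (Real.exp (-w t) - Real.exp (-u)) / t) (𝓝[>] 0)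
      (𝓝 (q₀ * Real.exp (-u))) := by
  refine ((tendsto_exp_mul_sub_one_div hw).mul_const (Real.exp (-u))).congr' ?_
  filter_upwards [self_mem_nhdsWithin] with t ht
  have ht0 : t ≠ 0 := ne_of_gt ht
  rw [mul_div_cancel₀ _ ht0, div_mul_eq_mul_div, sub_mul, ← Real.exp_add]
  ring_nf

/-- A pointwise supremum of continuous functions, over any index set, is lower semicontinuous, hence
measurable. -/
theorem measurable_of_isLUB {ι α : Type*} [TopologicalSpace α] [MeasurableSpace α] [BorelSpace α]
    {f : ι → α → ℝ} {g : α → ℝ} (hf : ∀ i, Continuous (f i))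
    (hg : ∀ x, IsLUB (range fun i => f i x) (g x)) : Measurable g := by
  refine measurable_of_Ioi fun b => IsOpen.measurableSet ?_
  have h : g ⁻¹' Ioi b = ⋃ i, f i ⁻¹' Ioi b := by
    ext x
    simp [lt_isLUB_iff (hg x)]
  rw [h]
  exact isOpen_iUnion fun i => isOpen_Ioi.preimage (hf i)

/-- A pointwise infimum of continuous functions, over any index set, is upper semicontinuous, hence
measurable. -/
theorem measurable_of_isGLB {ι α : Type*} [TopologicalSpace α] [MeasurableSpace α] [BorelSpace α]
    {f : ι → α → ℝ} {g : α → ℝ} (hf : ∀ i, Continuous (f i))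
    (hg : ∀ x, IsGLB (range fun i => f i x) (g x)) : Measurable g := by
  refine measurable_of_Iio fun b => IsOpen.measurableSet ?_
  have h : g ⁻¹' Iio b = ⋃ i, f i ⁻¹' Iio b := by
    ext x
    simp [isGLB_lt_iff (hg x)]
  rw [h]
  exact isOpen_iUnion fun i => isOpen_Iio.preimage (hf i)

variable [FiniteDimensional ℝ F]

/-- A finite convex function has an affine minorant. -/
theorem exists_inner_add_le {χ : F → ℝ} (hχ : ConvexOn ℝ univ χ) :
    ∃ (a : F) (b : ℝ), ∀ y, inner ℝ a y + b ≤ χ y := by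
  have hc : ContinuousOn χ univ := hχ.continuousOn isOpen_univ
  obtain ⟨l, b, hle, -⟩ := hχ.exists_affine_le_of_lt (𝕜 := ℝ) (mem_univ 0) (sub_one_lt (χ 0))
    isClosed_univ hc.lowerSemicontinuousOn
  refine ⟨(InnerProductSpace.toDual ℝ F).symm l, b, fun y => ?_⟩
  simpa using hle ⟨y, mem_univ y⟩

variable {U V φ ψ : F → ℝ} {W : ℝ → F → ℝ}

theorem sub_mul_conj_gradient_le (hU : IsSuperlinearConvex U)
    (hψ : ∀ y, IsLUB (range fun z => inner ℝ z y - V z) (ψ y))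
    (hW : ∀ t, 0 < t → ∀ x, IsGLB (range fun z => U (x - t • z) + t * V z) (W t x))
    {t : ℝ} (ht : 0 < t) (x : F) : U x - t * ψ (gradient U x) ≤ W t x := by
  refine (le_isGLB_iff (hW t ht x)).2 ?_
  rintro _ ⟨z, rfl⟩
  have h1 := hU.add_inner_gradient_le x (x - t • z)
  have h2 := (hψ (gradient U x)).1 (mem_range_self z)
  simp only [sub_sub_cancel_left, inner_neg_right, inner_smul_right] at h1
  rw [real_inner_comm] at h2
  dsimp only
  nlinarith

/-- The pointwise derivative `d/dt W t x = -V* (∇ U x)` at `t = 0⁺` of the infimal convolution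
`W t = U □ (V t)`. -/
theorem tendsto_sub_div_conj_gradient (hU : IsSuperlinearConvex U)
    (hψ : ∀ y, IsLUB (range fun z => inner ℝ z y - V z) (ψ y))
    (hW : ∀ t, 0 < t → ∀ x, IsGLB (range fun z => U (x - t • z) + t * V z) (W t x)) (x : F) :
    Tendsto (fun t => (U x - W t x) / t) (𝓝[>] 0) (𝓝 (ψ (gradient U x))) := by
  refine tendsto_order.2 ⟨fun b hb => ?_, fun b hb => ?_⟩
  · obtain ⟨_, ⟨z, rfl⟩, hz⟩ := (lt_isLUB_iff (hψ _)).1 hb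
    have hγ : HasDerivAt (fun t : ℝ => x - t • z) (-z) 0 := by
      simpa using ((hasDerivAt_id (0 : ℝ)).smul_const z).const_sub x
    have hd := (hasDerivAt_comp_gradient hU.differentiable hγ).neg.tendsto_slope_zero_right
    simp only [zero_smul, sub_zero, inner_neg_right, neg_neg, zero_add, smul_eq_mul,
      Pi.neg_apply] at hd
    have hlt : b + V z < inner ℝ (gradient U x) z := by
      rw [real_inner_comm]; linarith
    filter_upwards [hd.eventually_const_lt hlt, self_mem_nhdsWithin] with t h1 ht
    have ht' : (0 : ℝ) < t := ht
    have h2 : W t x ≤ U (x - t • z) + t * V z := (hW t ht x).1 (mem_range_self z)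
    rw [lt_inv_mul_iff₀ ht'] at h1
    rw [lt_div_iff₀ ht']
    linarith
  · filter_upwards [self_mem_nhdsWithin] with t ht
    have ht' : (0 : ℝ) < t := ht
    refine lt_of_le_of_lt ?_ hb
    rw [div_le_iff₀ ht']
    linarith [sub_mul_conj_gradient_le hU hψ hW ht' x]

/-- The function `(1 + s) U ((x + s a) / (1 + s)) + s b`; for convex `U` and `s ≥ 0` it is the
conjugate of `(1 + s) U* - s (⟪a, ·⟫ + b)`. -/
noncomputable def dilation (U : F → ℝ) (a : F) (b s : ℝ) (x : F) : ℝ :=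
  (1 + s) * U ((1 + s)⁻¹ • (x + s • a)) + s * b

/-- This is where admissibility enters. If `⟪a, ·⟫ + b` is an affine minorant of `U* - c V*` and
`t = c s`, then `U* + t V* = (1 + s) U* - s (U* - c V*) ≤ (1 + s) U* - s (⟪a, ·⟫ + b)`, and passing
to conjugates reverses the inequality. -/
theorem exists_dilation_le (hU : IsSuperlinearConvex U)
    (hφ : ∀ y, IsLUB (range fun x => inner ℝ x y - U x) (φ y))
    (hψ : ∀ y, IsLUB (range fun z => inner ℝ z y - V z) (ψ y))
    (hW : ∀ t, 0 < t → ∀ x, IsGLB (range fun z => U (x - t • z) + t * V z) (W t x))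
    {c : ℝ} (hc : 0 < c) (hχ : ConvexOn ℝ univ fun y => φ y - c * ψ y) :
    ∃ (a : F) (b : ℝ), ∀ t, 0 < t → ∀ x, dilation U a b (t / c) x ≤ W t x := by
  obtain ⟨a, b, hab⟩ := exists_inner_add_le hχ
  refine ⟨a, b, fun t ht x => (le_isGLB_iff (hW t ht x)).2 ?_⟩
  rintro _ ⟨z, rfl⟩
  obtain ⟨s, rfl⟩ : ∃ s, t = c * s := ⟨t / c, by field_simp⟩
  have hs : 0 < s := (mul_pos_iff_of_pos_left hc).1 ht
  have h1s : (1 + s) ≠ 0 := by positivity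
  rw [mul_div_cancel_left₀ _ hc.ne']
  simp only [dilation]
  set w := (1 + s)⁻¹ • (x + s • a) with hw
  set y := gradient U w with hy
  have hwx : inner ℝ x y + s * inner ℝ a y = (1 + s) * inner ℝ w y := by
    rw [hw, real_inner_smul_left, inner_add_left, real_inner_smul_left, mul_inv_cancel_left₀ h1s]
  -- equality in the Fenchel-Young inequality at a point and its gradient
  have hwy : φ y ≤ inner ℝ w y - U w := by
    refine (isLUB_le_iff (hφ y)).2 ?_
    rintro _ ⟨p, rfl⟩
    have := hU.add_inner_gradient_le w p
    rw [← hy, inner_sub_right, real_inner_comm p y, real_inner_comm w y] at this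
    dsimp only
    linarith
  have h1 := (hφ y).1 (mem_range_self (x - (c * s) • z))
  have h2 := (hψ y).1 (mem_range_self z)
  have h3 := hab y
  simp only [inner_sub_left, real_inner_smul_left] at h1
  nlinarith [mul_le_mul_of_nonneg_left h2 ht.le, mul_le_mul_of_nonneg_left h3 hs.le,
    mul_le_mul_of_nonneg_left hwy (by positivity : 0 ≤ 1 + s)]

theorem hasDerivAt_dilation (hU : Differentiable ℝ U) (a : F) (b : ℝ) (x : F) :
    HasDerivAt (fun s => dilation U a b s x) (b + U x - inner ℝ (gradient U x) (x - a)) 0 := by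
  have h1 : HasDerivAt (fun s : ℝ => 1 + s) 1 0 := (hasDerivAt_id (0 : ℝ)).const_add 1
  have h2 : HasDerivAt (fun s : ℝ => x + s • a) a 0 := by
    simpa using ((hasDerivAt_id (0 : ℝ)).smul_const a).const_add x
  have hγ := (h1.fun_inv (by norm_num)).fun_smul h2
  have h3 := (h1.mul (hasDerivAt_comp_gradient hU hγ)).add
    ((hasDerivAt_id (0 : ℝ)).mul_const b)
  refine h3.congr_deriv ?_
  have : a + -x = -(x - a) := by abel
  simp [this, -inner_gradient_left, -neg_sub]
  ring

/-! ### The first variation for real-valued functions -/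

variable [MeasurableSpace F] [BorelSpace F]

theorem integrable_exp_neg_dilation (hU : IsSuperlinearConvex U) (a : F) (b : ℝ) {s : ℝ}
    (hs : 0 ≤ s) : Integrable fun x => Real.exp (-dilation U a b s x) := by
  have h1 := ((hU.integrable_exp_neg_mul (by positivity : 0 < 1 + s)).comp_smul
    (inv_ne_zero (by positivity : 1 + s ≠ 0))).comp_add_right (s • a)
  refine (h1.const_mul (Real.exp (-(s * b)))).congr (ae_of_all _ fun x => ?_)
  simp only [dilation, ← Real.exp_add]
  ring_nf

/-- The change of variables `x ↦ (1 + s) x - s a`. -/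
theorem integral_exp_neg_dilation (U : F → ℝ) (a : F) (b : ℝ) {s : ℝ} (hs : 0 ≤ s) :
    ∫ x, Real.exp (-dilation U a b s x) =
      Real.exp (-(s * b)) * ((1 + s) ^ Module.finrank ℝ F *
        ∫ x, Real.exp (-((1 + s) * U x))) := by
  have h1 := integral_add_right_eq_self (μ := (volume : Measure F))
    (fun y => Real.exp (-((1 + s) * U ((1 + s)⁻¹ • y)))) (s • a)
  rw [Measure.integral_comp_inv_smul volume (fun y => Real.exp (-((1 + s) * U y))) (1 + s),
    abs_of_nonneg (by positivity), smul_eq_mul] at h1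
  rw [← h1, ← integral_const_mul]
  refine integral_congr_ae (ae_of_all _ fun x => ?_)
  simp only [dilation, ← Real.exp_add]
  ring_nf

/-- The integrals of the difference quotients of `e ^ (-dilation U a b s)` converge to the integral
of their pointwise limit: the former are computed by a change of variables, the latter by the
divergence theorem. -/
theorem tendsto_integral_dilation (hU : IsSuperlinearConvex U) (a : F) (b : ℝ) :
    Tendsto (fun s => ∫ x, (Real.exp (-dilation U a b s x) - Real.exp (-U x)) / s) (𝓝[>] 0)
      (𝓝 (∫ x, (inner ℝ (gradient U x) (x - a) - U x - b) * Real.exp (-U x))) := by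
  obtain ⟨hUi, hK⟩ := hU.hasDerivAt_integral_exp_neg_mul
  obtain ⟨hHi, hH⟩ := hU.integral_inner_gradient_mul_exp_neg a
  have hfi := hU.integrable_exp_neg
  have h1 : HasDerivAt (fun s : ℝ => (1 + s) ^ Module.finrank ℝ F) (Module.finrank ℝ F) 0 := by
    simpa using! ((hasDerivAt_id (0 : ℝ)).const_add 1).pow (Module.finrank ℝ F)
  have h2 : HasDerivAt (fun s : ℝ => Real.exp (-(s * b))) (-b) 0 := by
    simpa using! ((hasDerivAt_id (0 : ℝ)).mul_const b).neg.exp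
  have h3 := (h2.mul (h1.mul hK)).tendsto_slope_zero_right
  have hlim : ∫ x, (inner ℝ (gradient U x) (x - a) - U x - b) * Real.exp (-U x) =
      Module.finrank ℝ F * (∫ x, Real.exp (-U x)) - (∫ x, U x * Real.exp (-U x)) -
        b * ∫ x, Real.exp (-U x) := by
    rw [← hH, ← integral_const_mul, ← integral_sub' hHi hUi,
      ← integral_sub' (hHi.sub hUi) (hfi.const_mul b)]
    exact integral_congr_ae (ae_of_all _ fun x => by simp only [Pi.sub_apply]; ring)
  rw [hlim]
  have h4 : Module.finrank ℝ F * (∫ x, Real.exp (-U x)) - (∫ x, U x * Real.exp (-U x)) -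
        b * ∫ x, Real.exp (-U x) =
      -b * ((1 + 0) ^ Module.finrank ℝ F * ∫ x, Real.exp (-((1 + 0) * U x))) +
        Real.exp (-(0 * b)) * (Module.finrank ℝ F * (∫ x, Real.exp (-((1 + 0) * U x))) +
          (1 + 0) ^ Module.finrank ℝ F * -∫ x, U x * Real.exp (-U x)) := by
    simp
    ring
  rw [h4]
  refine h3.congr' ?_
  filter_upwards [self_mem_nhdsWithin] with s hs
  have hs' : (0 : ℝ) < s := hs
  rw [integral_div, integral_sub (integrable_exp_neg_dilation hU a b hs'.le) hfi,
    integral_exp_neg_dilation U a b hs'.le]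
  simp [div_eq_inv_mul]

theorem integrable_exp_neg_of_isGLB (hU : IsSuperlinearConvex U)
    (hW : ∀ t, 0 < t → ∀ x, IsGLB (range fun z => U (x - t • z) + t * V z) (W t x))
    {c : ℝ} (hc : 0 < c) {a : F} {b : ℝ}
    (hab : ∀ t, 0 < t → ∀ x, dilation U a b (t / c) x ≤ W t x) {t : ℝ} (ht : 0 < t) :
    Integrable fun x => Real.exp (-W t x) := by
  have hUc := hU.differentiable.continuous
  have hm : Measurable (W t) :=
    measurable_of_isGLB (f := fun z x => U (x - t • z) + t * V z) (fun z => by fun_prop) (hW t ht)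
  refine (integrable_exp_neg_dilation hU a b (div_pos ht hc).le).mono'
    (by fun_prop) (ae_of_all _ fun x => ?_)
  rw [Real.norm_of_nonneg (Real.exp_nonneg _)]
  gcongr
  exact hab t ht x

/-- The first variation formula for real-valued functions; `φ`, `ψ` are the conjugates of `U`, `V`,
and `W t = U □ (V t)` is written with the substitution `y = t • z` in the infimum. -/
theorem tendsto_integral_exp_neg_sub_div (hU : IsSuperlinearConvex U)
    (hφ : ∀ y, IsLUB (range fun x => inner ℝ x y - U x) (φ y))
    (hψ : ∀ y, IsLUB (range fun z => inner ℝ z y - V z) (ψ y))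
    (hW : ∀ t, 0 < t → ∀ x, IsGLB (range fun z => U (x - t • z) + t * V z) (W t x))
    {c : ℝ} (hc : 0 < c) (hχ : ConvexOn ℝ univ fun y => φ y - c * ψ y) :
    (∀ t, 0 < t → Integrable fun x => Real.exp (-W t x)) ∧
    Integrable (fun x => ψ (gradient U x) * Real.exp (-U x)) ∧
    Tendsto (fun t => ((∫ x, Real.exp (-W t x)) - ∫ x, Real.exp (-U x)) / t) (𝓝[>] 0)
      (𝓝 (∫ x, ψ (gradient U x) * Real.exp (-U x))) := by
  obtain ⟨a, b, hab⟩ := exists_dilation_le hU hφ hψ hW hc hχ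
  have hWi : ∀ t, 0 < t → Integrable fun x => Real.exp (-W t x) := fun t ht =>
    integrable_exp_neg_of_isGLB hU hW hc hab ht
  have hfi := hU.integrable_exp_neg
  obtain ⟨hHi, -⟩ := hU.integral_inner_gradient_mul_exp_neg a
  obtain ⟨hUi, -⟩ := hU.hasDerivAt_integral_exp_neg_mul
  have hUc := hU.differentiable.continuous
  have hgc := hU.continuous_gradient
  have hψm : Measurable ψ :=
    measurable_of_isLUB (f := fun z y => inner ℝ z y - V z) (fun z => by fun_prop) hψ
  set G' : F → ℝ := fun x =>
    1 / c * ((inner ℝ (gradient U x) (x - a) - U x - b) * Real.exp (-U x)) with hG'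
  have hG'i : Integrable G' := by
    refine (((hHi.sub hUi).sub (hfi.const_mul b)).const_mul (1 / c)).congr (ae_of_all _ fun x => ?_)
    simp only [hG', Pi.sub_apply]
    ring
  have hdivc : Tendsto (fun t : ℝ => t / c) (𝓝[>] 0) (𝓝[>] 0) := by
    refine tendsto_nhdsWithin_iff.2 ⟨?_, ?_⟩
    · simpa using (tendsto_nhdsWithin_of_tendsto_nhds (s := Ioi 0)
        (tendsto_id (α := ℝ) (x := 𝓝 0))).div_const c
    · filter_upwards [self_mem_nhdsWithin] with t ht using div_pos ht hc
  have hgl : ∀ x, Tendsto (fun t => (Real.exp (-W t x) - Real.exp (-U x)) / t) (𝓝[>] 0)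
      (𝓝 (ψ (gradient U x) * Real.exp (-U x))) := fun x =>
    tendsto_exp_neg_sub_div (tendsto_sub_div_conj_gradient hU hψ hW x)
  have hGl : ∀ x, Tendsto (fun t => (Real.exp (-dilation U a b (t / c) x) - Real.exp (-U x)) / t)
      (𝓝[>] 0) (𝓝 (G' x)) := fun x => by
    have h1 := (hasDerivAt_dilation hU.differentiable a b x).tendsto_slope_zero_right.neg
    have h2 : Tendsto (fun s => (U x - dilation U a b s x) / s) (𝓝[>] 0)
        (𝓝 (inner ℝ (gradient U x) (x - a) - U x - b)) := by
      convert h1 using 2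
      · simp [dilation, div_eq_inv_mul]
        ring
      · ring
    refine (((tendsto_exp_neg_sub_div h2).comp hdivc).const_mul (1 / c)).congr fun t => ?_
    simp only [Function.comp_apply]
    field_simp
  have hBg : ∀ᶠ t : ℝ in 𝓝[>] 0, ∀ x,
      -((|V 0|) * Real.exp (-U x)) ≤ (Real.exp (-W t x) - Real.exp (-U x)) / t := by
    filter_upwards [self_mem_nhdsWithin] with t ht x
    have ht' : (0 : ℝ) < t := ht
    have h1 : W t x ≤ U (x - t • 0) + t * V 0 := (hW t ht x).1 (mem_range_self 0)
    rw [smul_zero, sub_zero] at h1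
    have h2 : Real.exp (-U x) * Real.exp (-(t * V 0)) ≤ Real.exp (-W t x) := by
      rw [← Real.exp_add]; gcongr; linarith
    have h3 := Real.add_one_le_exp (-(t * V 0))
    have h4 := mul_le_mul_of_nonneg_left h3 (Real.exp_nonneg (-U x))
    have h5 := mul_le_mul_of_nonneg_left (le_abs_self (V 0))
      (mul_nonneg ht'.le (Real.exp_nonneg (-U x)))
    rw [le_div_iff₀ ht']
    nlinarith
  have hgG : ∀ᶠ t : ℝ in 𝓝[>] 0, ∀ x, (Real.exp (-W t x) - Real.exp (-U x)) / t ≤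
      (Real.exp (-dilation U a b (t / c) x) - Real.exp (-U x)) / t := by
    filter_upwards [self_mem_nhdsWithin] with t ht x
    have ht' : (0 : ℝ) < t := ht
    have := hab t ht x
    gcongr
  have hint : Tendsto (fun t => ∫ x, (Real.exp (-dilation U a b (t / c) x) - Real.exp (-U x)) / t)
      (𝓝[>] 0) (𝓝 (∫ x, G' x)) := by
    rw [hG', integral_const_mul]
    refine (((tendsto_integral_dilation hU a b).comp hdivc).const_mul (1 / c)).congr fun t => ?_
    simp only [Function.comp_apply]
    rw [← integral_const_mul]
    refine integral_congr_ae (ae_of_all _ fun x => ?_)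
    field_simp
  have hmain := tendsto_integral_of_le_of_tendsto_integral
    (by filter_upwards [self_mem_nhdsWithin] with t ht using ((hWi t ht).sub hfi).div_const t)
    (by
      filter_upwards [self_mem_nhdsWithin] with t ht using
        ((integrable_exp_neg_dilation hU a b (div_pos ht hc).le).sub hfi).div_const t)
    (hfi.const_mul (|V 0|)) hG'i hBg hgG hgl hGl hint
  refine ⟨hWi, ?_, hmain.congr' ?_⟩
  · refine (((hfi.const_mul (|V 0|)).abs).add hG'i.abs).mono' ?_ (ae_of_all _ fun x => ?_)
    · exact ((hψm.comp hgc.measurable).mul (by fun_prop)).aestronglyMeasurable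
    · have h1 := ge_of_tendsto (hgl x) (hBg.mono fun t ht => ht x)
      have h2 := le_of_tendsto_of_tendsto (hgl x) (hGl x) (hgG.mono fun t ht => ht x)
      refine abs_le.2 ⟨?_, ?_⟩
      · simp only [Pi.add_apply]
        linarith [le_abs_self (|V 0| * Real.exp (-U x)), abs_nonneg (G' x)]
      · simp only [Pi.add_apply]
        linarith [le_abs_self (G' x), abs_nonneg (|V 0| * Real.exp (-U x))]
  · filter_upwards [self_mem_nhdsWithin] with t ht
    rw [integral_div, integral_sub (hWi t ht) hfi]

end Variation

/-! ### From extended real valued functions to real valued ones -/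

section ExtendedReal

variable {n : ℕ}

theorem isConvex_coe_iff {U : E n → ℝ} :
    IsConvex (fun x => (U x : EReal)) ↔ ConvexOn ℝ univ U := by
  rw [convexOn_iff_convex_epigraph, IsConvex]
  simp

theorem expNeg_apply_of_eq_coe {u : E n → EReal} {x : E n} {r : ℝ} (h : u x = r) :
    expNeg u x = Real.exp (-r) := by
  rw [expNeg, h, ← EReal.coe_neg, EReal.exp_coe, ENNReal.toReal_ofReal (Real.exp_nonneg _)]

/-- Membership in `𝒜'` gives `f = e ^ (-U)` with `U` real-valued: `f` is positive, since the domain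
of `-log f` is the whole space. -/
theorem exists_isSuperlinearConvex_of_mem_classA' {f : E n → ℝ} (hf : f ∈ classA' n) :
    ∃ U : E n → ℝ, IsSuperlinearConvex U ∧ (negLog f = fun x => (U x : EReal)) ∧
      f = fun x => Real.exp (-U x) := by
  obtain ⟨-, ⟨-, -, hconv, -⟩, hdom, hC2, hgrowth⟩ := hf
  have hfin : ∀ x, x ∈ dom (negLog f) := fun x => hdom ▸ mem_univ x
  have hU : negLog f = fun x => ((negLog f x).toReal : EReal) := by
    funext x
    exact (EReal.coe_toReal (hfin x).2 (hfin x).1).symm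
  have hint : ∀ x, x ∈ interior (dom (negLog f)) := fun x => by
    rw [hdom, interior_univ]; exact mem_univ x
  refine ⟨fun x => (negLog f x).toReal, ⟨?_, ?_, ?_, hgrowth⟩, hU, ?_⟩
  · rw [hU] at hconv
    exact isConvex_coe_iff.1 hconv
  · exact fun x => (hC2 x (hint x)).1
  · exact continuous_iff_continuousAt.2 fun x => (hC2 x (hint x)).2.1.continuousAt
  · funext x
    have hpos : 0 < f x := by
      by_contra h
      refine (hfin x).2 ?_
      rw [negLog, ENNReal.log_ofReal, if_pos (not_lt.1 h), EReal.neg_bot]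
    have hlog : negLog f x = ((-Real.log (f x) : ℝ) : EReal) := by
      rw [negLog, ENNReal.log_ofReal_of_pos hpos, EReal.coe_neg]
    dsimp only
    rw [hlog, EReal.toReal_coe, neg_neg, Real.exp_log hpos]

theorem exists_conj_eq_coe {V : E n → ℝ} (hV : IsSuperlinearConvex V) :
    ∃ ψ : E n → ℝ, (∀ y, conj (fun x => (V x : EReal)) y = (ψ y : EReal)) ∧
      ∀ y, IsLUB (range fun z => inner ℝ z y - V z) (ψ y) := by
  refine ⟨fun y => ⨆ z, (inner ℝ z y - V z), fun y => ?_, fun y =>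
    isLUB_ciSup (hV.bddAbove_inner_sub y)⟩
  rw [EReal.coe_strictMono.monotone.map_ciSup_of_continuousAt
    continuous_coe_real_ereal.continuousAt (hV.bddAbove_inner_sub y)]
  simp [conj]

/-- For `t > 0` the combination `f ⊕ t · g` is `e ^ (-W t)` with `W t` a real infimum; lower bounds
of `U` and `V` keep it finite. -/
theorem exists_comb_eq_exp_neg {f g : E n → ℝ} {U V : E n → ℝ}
    (hU : IsSuperlinearConvex U) (hV : IsSuperlinearConvex V)
    (hf : negLog f = fun x => (U x : EReal)) (hg : negLog g = fun x => (V x : EReal)) :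
    ∃ W : ℝ → E n → ℝ, ∀ t, 0 < t → (comb 1 f t g = fun x => Real.exp (-W t x)) ∧
      ∀ x, IsGLB (range fun z => U (x - t • z) + t * V z) (W t x) := by
  obtain ⟨m, hm⟩ := hU.exists_forall_le
  obtain ⟨m', hm'⟩ := hV.exists_forall_le
  refine ⟨fun t x => ⨅ z, (U (x - t • z) + t * V z), fun t ht => ?_⟩
  have hbdd : ∀ x, BddBelow (range fun z => U (x - t • z) + t * V z) := by
    refine fun x => ⟨m + t * m', ?_⟩
    rintro _ ⟨z, rfl⟩
    exact add_le_add (hm _) (mul_le_mul_of_nonneg_left (hm' z) ht.le)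
  refine ⟨funext fun x => expNeg_apply_of_eq_coe ?_, fun x => isGLB_ciInf (hbdd x)⟩
  rw [EReal.coe_strictMono.monotone.map_ciInf_of_continuousAt
    continuous_coe_real_ereal.continuousAt (hbdd x), infConv]
  refine ((Homeomorph.smulOfNeZero t ht.ne').toEquiv.iInf_congr fun z => ?_).symm
  simp [rightMul, hf, hg, ht, inv_smul_smul₀ ht.ne']

theorem comb_one_zero {f : E n → ℝ} (g : E n → ℝ) {U : E n → ℝ}
    (hf : negLog f = fun x => (U x : EReal)) :
    comb 1 f 0 g = fun x => Real.exp (-U x) := by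
  refine funext fun x => expNeg_apply_of_eq_coe (le_antisymm ?_ (le_iInf fun y => ?_))
  · refine (iInf_le _ (0 : E n)).trans ?_
    simp [rightMul, hf]
  · rcases eq_or_ne y 0 with rfl | hy
    · simp [rightMul, hf]
    · simp [rightMul, hf, hy]

variable {f : E n → ℝ} {U : E n → ℝ}

theorem integrable_gradMeasure_iff (hU : IsSuperlinearConvex U)
    (hf : negLog f = fun x => (U x : EReal)) (hf' : f = fun x => Real.exp (-U x))
    {ψ : E n → ℝ} (hψ : Measurable ψ) :
    Integrable ψ (gradMeasure f) ↔
      Integrable fun x => ψ (gradient U x) * Real.exp (-U x) := by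
  have hUc := hU.differentiable.continuous
  have hgrad : grad (negLog f) = gradient U := by rw [hf]; rfl
  rw [gradMeasure, hgrad, integrable_map_measure hψ.aestronglyMeasurable
      hU.continuous_gradient.measurable.aemeasurable,
    integrable_withDensity_iff (by rw [hf']; fun_prop) (by simp)]
  simp [hf', ENNReal.toReal_ofReal (Real.exp_nonneg _)]

theorem integral_gradMeasure (hU : IsSuperlinearConvex U)
    (hf : negLog f = fun x => (U x : EReal)) (hf' : f = fun x => Real.exp (-U x))
    {ψ : E n → ℝ} (hψ : Measurable ψ) :
    ∫ y, ψ y ∂gradMeasure f = ∫ x, ψ (gradient U x) * Real.exp (-U x) := by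
  have hUc := hU.differentiable.continuous
  have hgrad : grad (negLog f) = gradient U := by rw [hf]; rfl
  rw [gradMeasure, hgrad, integral_map hU.continuous_gradient.measurable.aemeasurable
      hψ.aestronglyMeasurable,
    integral_withDensity_eq_integral_toReal_smul (by rw [hf']; fun_prop) (by simp)]
  simp [hf', ENNReal.toReal_ofReal (Real.exp_nonneg _), mul_comm]

end ExtendedReal

end LogConcave

theorem theorem4p1 (n : ℕ) (hn : 1 ≤ n) (f g : LogConcave.E n → ℝ)
    (hf : f ∈ LogConcave.classA' n) (hg : g ∈ LogConcave.classA' n)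
    (hfg : LogConcave.IsAdmissible f g) :
    (∀ t : ℝ, 0 ≤ t → Integrable (LogConcave.comb 1 f t g) volume) ∧
    ∃ ψ : LogConcave.E n → ℝ,
      (∀ y, LogConcave.conj (LogConcave.negLog g) y = ((ψ y : ℝ) : EReal)) ∧
      Integrable ψ (LogConcave.gradMeasure f) ∧
      LogConcave.HasFirstVariation f g (∫ y, ψ y ∂(LogConcave.gradMeasure f)) := by
  obtain ⟨U, hU, hfU, hfe⟩ := LogConcave.exists_isSuperlinearConvex_of_mem_classA' hf
  obtain ⟨V, hV, hgV, -⟩ := LogConcave.exists_isSuperlinearConvex_of_mem_classA' hg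
  obtain ⟨φ, hφ, hφ'⟩ := LogConcave.exists_conj_eq_coe hU
  obtain ⟨ψ, hψ, hψ'⟩ := LogConcave.exists_conj_eq_coe hV
  obtain ⟨W, hW⟩ := LogConcave.exists_comb_eq_exp_neg hU hV hfU hgV
  obtain ⟨c, hc, hconv⟩ := hfg
  have hχ : ConvexOn ℝ univ fun y => φ y - c * ψ y := by
    rw [← LogConcave.isConvex_coe_iff]
    simpa [hfU, hgV, hφ, hψ] using hconv
  have hVc := hV.differentiable.continuous
  have hψm : Measurable ψ :=
    LogConcave.measurable_of_isLUB (f := fun z y => inner ℝ z y - V z) (fun z => by fun_prop) hψ'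
  obtain ⟨hWi, hψi, hlim⟩ := LogConcave.tendsto_integral_exp_neg_sub_div hU hφ' hψ'
    (fun t ht => (hW t ht).2) hc hχ
  refine ⟨fun t ht => ?_, ψ, fun y => by rw [hgV, hψ], ?_, ?_⟩
  · rcases ht.eq_or_lt with rfl | ht
    · rw [LogConcave.comb_one_zero g hfU]
      exact hU.integrable_exp_neg
    · rw [(hW t ht).1]
      exact hWi t ht
  · exact (LogConcave.integrable_gradMeasure_iff hU hfU hfe hψm).2 hψi
  · rw [LogConcave.integral_gradMeasure hU hfU hfe hψm]
    refine hlim.congr' ?_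
    filter_upwards [self_mem_nhdsWithin] with t ht
    rw [(hW t ht).1, LogConcave.totalMass, LogConcave.totalMass, hfe]
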